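/- Let $d\ge 0$, let $\mathcal L_d$ be Lebesgue measure on $\mathbb R^d$, and let $M$ be the space of locally finite Borel measures on $\mathbb R^d$ with the $\sigma$-field generated by the maps $\varphi\mapsto\varphi(B)$, $B$ Borel. Let $(\Omega,\mathcal F)$ be a measurable space with a measurable flow $(\theta_s)_{s\in\mathbb R^d}$, i.e. $(\omega,s)\mapsto\theta_s\omega$ is measurable, $\theta_0=\mathrm{id}$ and $\theta_s\circ\theta_t=\theta_{s+t}$; for $\varphi\in M$ put $(\theta_s\varphi)(B)=\varphi(B+s)$. Let $\mathbb P$ be a probability measure on $\Omega$ that is invariant under every $\theta_s$ and ergodic (events invariant under all $\theta_s$ have probability $0$ or $1$), and let $\Psi:\Omega\to M$ be measurable and flow-adapted, i.e. $\Psi_{\theta_s\omega}=\theta_s\Psi_\omega$. Assume that $\Psi$ has intensity $\lambda\in(0,\infty)$, i.e. $\mathbb E[\Psi(B)]=\lambda\mathcal L_d(B)$ for all Borel $B$, and put $\Phi=\lambda\mathcal L_d$. Let $\mathbb P_\Psi$ be the Palm probability measure of $\Psi$, $$\mathbb P_\Psi(A)=\frac1{\lambda\mathcal L_d(B)}\,\mathbb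 E\Big[\int_B \mathbb 1_A(\theta_s)\,\Psi(ds)\Big],\qquad A\in\mathcal F,$$ where $B$ is any Borel set with $0<\mathcal L_d(B)<\infty$; the Palm version of $\Psi$ is $\Psi$ considered under $\mathbb P_\Psi$. Let $F=F_\omega(x,\xi)\in[0,\infty)$ be jointly measurable in $(\omega,x,\xi)\in\Omega\times\mathbb R^d\times\mathbb R^d$ and flow-adapted, i.e. $F_{\theta_s\omega}(x,\xi)=F_\omega(x+s,\xi+s)$, and suppose that for $\mathbb P$-almost every $\omega$ it is a balancing density for $\Phi$ and $\Psi_\omega$: $\int F_\omega(x,\xi)\,\Psi_\omega(d\xi)\le 1$ for every $x$, with equality for $\Phi$-a.e. $x$, and $\int F_\omega(x,\xi)\,\Phi(dx)\le 1$ for every $\xi$, with equality for $\Psi_\omega$-a.e. $\xi$. Then $\mathbb P_\Psi$ is a probability measure, and the following hold, for random vectors $Y$ in $\mathbb R^d$ that may be defined on an extension of the probability space in question. (i) If $Y$, on an extension of $(\Omega,\mathcal F,\mathbb P)$, has conditional distribution $F(0,\cdot)\Psi$ given $\Psi$, i.e. the measure $C\mapsto\int_C F(0,\xi)\,\Psi(d\xi)$,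 then $Y$ is a shift-coupling of $\Psi$ and its Palm version: $\theta_Y\Psi$ has the same distribution on $M$ as $\Psi$ under $\mathbb P_\Psi$. (ii) If $Y$, on an extension of $(\Omega,\mathcal F,\mathbb P_\Psi)$, has conditional distribution $F(\cdot,0)\Phi$ given $\Psi$, i.e. the measure $C\mapsto\int_C F(x,0)\,\Phi(dx)$, then $\theta_Y\Psi$ has the same distribution on $M$ as $\Psi$ under $\mathbb P$. Here "$Y$ has conditional distribution $\kappa$ given $\Psi$" means that the probability of $\{\Psi\in A,\,Y\in C\}$ is the expectation of $\mathbb 1_{\{\Psi\in A\}}\,\kappa(C)$, for all measurable $A\subseteq M$ and $C\subseteq\mathbb R^d$. -/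

import Mathlib

open MeasureTheory Set
open scoped ENNReal NNReal

noncomputable section

/-- `ℝ^d`, with its Borel `σ`-field and Lebesgue measure `volume`. -/
abbrev Rd (d : ℕ) : Type := EuclideanSpace ℝ (Fin d)

/-- The space `M` of locally finite Borel measures on `ℝ^d`. As a subtype of `Measure (Rd d)` it
carries the smallest `σ`-field that makes all evaluations `φ ↦ φ B`, `B` Borel, measurable. -/
abbrev LFMeasure (d : ℕ) : Type := {φ : Measure (Rd d) // IsLocallyFiniteMeasure φ}

/-- The translate `θ_s φ` of a locally finite measure: `(θ_s φ)(B) = φ (B + s)`. -/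
def LFMeasure.shift {d : ℕ} (s : Rd d) (φ : LFMeasure d) : LFMeasure d :=
  ⟨φ.1.map (fun x => x - s), by
    have : IsLocallyFiniteMeasure φ.1 := φ.2
    refine ⟨fun x => ?_⟩
    obtain ⟨U, hU, hfin⟩ := φ.1.finiteAt_nhds (x + s)
    refine ⟨(fun y => y + s) ⁻¹' U, (continuous_id.add continuous_const).continuousAt hU, ?_⟩
    change φ.1.map (Homeomorph.subRight s).toMeasurableEquiv _ < ∞
    rw [MeasurableEquiv.map_apply]
    convert hfin using 2
    ext y
    simp⟩

lemma LFMeasure.shift_apply {d : ℕ} (s : Rd d) (φ : LFMeasure d) (B : Set (Rd d)) :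
    (LFMeasure.shift s φ).1 B = φ.1 ((fun x => x + s) '' B) := by
  change (φ.1.map (Homeomorph.subRight s).toMeasurableEquiv) B = _
  rw [MeasurableEquiv.map_apply]
  congr 1
  ext x
  simp [sub_eq_add_neg]

/-- A measurable flow `(θ_s)`, `s ∈ ℝ^d`, on a measurable space `Ω`. -/
structure MeasurableFlow (d : ℕ) (Ω : Type*) [MeasurableSpace Ω] where
  toFun : Rd d → Ω → Ω
  measurable_uncurry : Measurable (fun p : Ω × Rd d => toFun p.2 p.1)
  map_zero : ∀ ω, toFun 0 ω = ω
  map_add : ∀ s t ω, toFun s (toFun t ω) = toFun (s + t) ω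

section Random

variable {d : ℕ} {Ω : Type*} [MeasurableSpace Ω]

/-- `P` is invariant under every `θ_s`. -/
def IsFlowStationary (θ : MeasurableFlow d Ω) (P : Measure Ω) : Prop :=
  ∀ s, MeasurePreserving (θ.toFun s) P P

/-- `P` is stationary and every event that is invariant under all `θ_s` has probability `0` or
`1`. -/
def IsFlowErgodic (θ : MeasurableFlow d Ω) (P : Measure Ω) : Prop :=
  IsFlowStationary θ P ∧
    ∀ A : Set Ω, MeasurableSet A → (∀ s, θ.toFun s ⁻¹' A = A) → P A = 0 ∨ P A = 1

/-- `(P, Ψ)` is an ergodic (stationary) random measure: `P` is an ergodic probability measure, and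
`Ψ : Ω → M` is measurable and flow-adapted. -/
structure IsErgodicRandomMeasure (θ : MeasurableFlow d Ω) (P : Measure Ω) (Ψ : Ω → LFMeasure d) :
    Prop where
  prob : IsProbabilityMeasure P
  ergodic : IsFlowErgodic θ P
  measurable : Measurable Ψ
  adapted : ∀ s ω, Ψ (θ.toFun s ω) = (Ψ ω).shift s

/-- `lam` is the intensity of the random measure `(P, Ψ)`: `E[Ψ(B)] = lam * vol(B)` for every
Borel set `B`. -/
def IsIntensity (P : Measure Ω) (Ψ : Ω → LFMeasure d) (lam : ℝ≥0∞) : Prop :=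
  ∀ B : Set (Rd d), MeasurableSet B → ∫⁻ ω, (Ψ ω).1 B ∂P = lam * volume B

/-- The Palm probability measure `P_Ψ` on `Ω`, computed with the window `B`:
`P_Ψ(A) = (lam * vol(B))⁻¹ * E[∫_B 1_A(θ_s) Ψ(ds)]`, see `palmMeasure_apply`. -/
def palmMeasure (θ : MeasurableFlow d Ω) (P : Measure Ω) (Ψ : Ω → LFMeasure d) (lam : ℝ≥0∞)
    (B : Set (Rd d)) : Measure Ω :=
  (lam * volume B)⁻¹ •
    P.bind (fun ω => ((Ψ ω).1.restrict B).map (fun s => θ.toFun s ω))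

lemma measurable_palm_integrand (θ : MeasurableFlow d Ω) {Ψ : Ω → LFMeasure d}
    (hΨ : Measurable Ψ) {B : Set (Rd d)} (hB : MeasurableSet B) :
    Measurable (fun ω => ((Ψ ω).1.restrict B).map (fun s => θ.toFun s ω)) := by
  refine Measure.measurable_of_measurable_coe _ fun A hA => ?_
  have hsec : ∀ ω, Measurable (fun s => θ.toFun s ω) := fun ω =>
    θ.measurable_uncurry.comp measurable_prodMk_left
  let T : Set (Ω × Rd d) := (fun p => θ.toFun p.2 p.1) ⁻¹' A
  have hT : MeasurableSet T := θ.measurable_uncurry hA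
  let κ : ℕ → ProbabilityTheory.Kernel Ω (Rd d) := fun n =>
    ⟨fun ω => ((Ψ ω).1.restrict B).restrict (Metric.closedBall 0 n), by
      refine Measure.measurable_of_measurable_coe _ fun C hC => ?_
      simp only [Measure.restrict_apply hC,
        Measure.restrict_apply (hC.inter Metric.isClosed_closedBall.measurableSet)]
      exact (Measure.measurable_coe
        ((hC.inter Metric.isClosed_closedBall.measurableSet).inter hB)).comp
          (measurable_subtype_coe.comp hΨ)⟩
  have hfin : ∀ n ω, IsFiniteMeasure (κ n ω) := fun n ω => by
    have : IsLocallyFiniteMeasure (Ψ ω).1 := (Ψ ω).2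
    refine ⟨?_⟩
    change (((Ψ ω).1.restrict B).restrict (Metric.closedBall 0 (n : ℝ))) univ < ∞
    rw [Measure.restrict_apply_univ]
    exact (Measure.restrict_apply_le _ _).trans_lt
      (isCompact_closedBall (0 : Rd d) n).measure_lt_top
  have key : ∀ ω, (((Ψ ω).1.restrict B).map (fun s => θ.toFun s ω)) A
      = ⨆ n, κ n ω (Prod.mk ω ⁻¹' T) := fun ω => by
    rw [Measure.map_apply (hsec ω) hA]
    change ((Ψ ω).1.restrict B) (Prod.mk ω ⁻¹' T) = ⨆ n : ℕ,
      (((Ψ ω).1.restrict B).restrict (Metric.closedBall 0 (n : ℝ))) (Prod.mk ω ⁻¹' T)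
    have hS : MeasurableSet (Prod.mk ω ⁻¹' T) := measurable_prodMk_left hT
    simp only [Measure.restrict_apply hS (s := Metric.closedBall _ _)]
    rw [← Monotone.measure_iUnion]
    · rw [← inter_iUnion, Metric.iUnion_closedBall_nat, inter_univ]
    · intro m n hmn
      exact inter_subset_inter_right _ (Metric.closedBall_subset_closedBall (by exact_mod_cast hmn))
  simp only [key]
  exact Measurable.iSup fun n =>
    ProbabilityTheory.Kernel.measurable_kernel_prodMk_left_of_finite hT (hfin n)

lemma palmMeasure_apply (θ : MeasurableFlow d Ω) (P : Measure Ω) {Ψ : Ω → LFMeasure d}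
    (hΨ : Measurable Ψ) (lam : ℝ≥0∞) {B : Set (Rd d)} (hB : MeasurableSet B)
    {A : Set Ω} (hA : MeasurableSet A) :
    palmMeasure θ P Ψ lam B A =
      (lam * volume B)⁻¹ * ∫⁻ ω, ∫⁻ s in B, A.indicator 1 (θ.toFun s ω) ∂(Ψ ω).1 ∂P := by
  have hsec : ∀ ω, Measurable (fun s => θ.toFun s ω) := fun ω =>
    θ.measurable_uncurry.comp measurable_prodMk_left
  rw [palmMeasure, Measure.smul_apply, smul_eq_mul,
    Measure.bind_apply hA (measurable_palm_integrand θ hΨ hB).aemeasurable]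
  congr 1
  refine lintegral_congr fun ω => ?_
  rw [← lintegral_indicator_one hA,
    lintegral_map (measurable_one.indicator hA) (hsec ω)]

end Random

section Density

variable {d : ℕ}

/-- A non-negative measurable `f(x, ξ)` whose integrals in `ξ` against `ψ` and in `x` against `φ`
are at most `1`. -/
structure IsSubBalancingDensity (φ ψ : Measure (Rd d)) (f : Rd d → Rd d → ℝ≥0) : Prop where
  measurable : Measurable (fun p : Rd d × Rd d => f p.1 p.2)
  left_le : ∀ x, ∫⁻ ξ, (f x ξ : ℝ≥0∞) ∂ψ ≤ 1
  right_le : ∀ ξ, ∫⁻ x, (f x ξ : ℝ≥0∞) ∂φ ≤ 1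

/-- A sub-balancing density for which both integrals equal `1` almost everywhere. -/
structure IsBalancingDensity (φ ψ : Measure (Rd d)) (f : Rd d → Rd d → ℝ≥0) : Prop extends
    IsSubBalancingDensity φ ψ f where
  left_eq : ∀ᵐ x ∂φ, ∫⁻ ξ, (f x ξ : ℝ≥0∞) ∂ψ = 1
  right_eq : ∀ᵐ ξ ∂ψ, ∫⁻ x, (f x ξ : ℝ≥0∞) ∂φ = 1

/-- `F_ω(x, ξ)` is jointly measurable and flow-adapted: `F_{θ_s ω}(x, ξ) = F_ω(x + s, ξ + s)`. -/
structure IsFlowAdaptedFunction {Ω : Type*} [MeasurableSpace Ω] (θ : MeasurableFlow d Ω)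
    (F : Ω → Rd d → Rd d → ℝ≥0) : Prop where
  measurable : Measurable (fun p : Ω × Rd d × Rd d => F p.1 p.2.1 p.2.2)
  adapted : ∀ s ω x ξ, F (θ.toFun s ω) x ξ = F ω (x + s) (ξ + s)

end Density

/-- The conditional distribution of `Y` given `X` is the random measure `κ`:
`P(X ∈ A, Y ∈ B) = E[1_{X ∈ A} κ(B)]` for all measurable `A`, `B`.
For `κ` that is a function of `X` this is the defining property of the conditional distribution.
For general `κ` it is implied both by "the conditional distribution of `Y` given `σ(X)` is a.s. `κ`"
and, when `κ` and `X` are functions of some `Z`, by "the conditional distribution of `Y` given `Z`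
is a.s. `κ`". -/
def HasCondDistribGiven {Ω S E : Type*} [MeasurableSpace Ω] [MeasurableSpace S]
    [MeasurableSpace E] (P : Measure Ω) (Y : Ω → E) (X : Ω → S) (κ : Ω → Measure E) : Prop :=
  ∀ A : Set S, MeasurableSet A → ∀ B : Set E, MeasurableSet B →
    P (X ⁻¹' A ∩ Y ⁻¹' B) = ∫⁻ ω in X ⁻¹' A, κ ω B ∂P

/-- Let `π : Ω' → Ω₁` exhibit `(Ω', P')` as an extension of the probability space `(Ω₁, P₁)`. The
random vector `Y` on `Ω'` is a shift-coupling of `(P₁, Φ₁)` and `(P₂, Φ₂)`: `θ_Y Φ₁` has the same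
distribution on `M` as `Φ₂` under `P₂`. -/
structure IsShiftCoupling {d : ℕ} {Ω' Ω₁ Ω₂ : Type*} [MeasurableSpace Ω'] [MeasurableSpace Ω₁]
    [MeasurableSpace Ω₂] (P' : Measure Ω') (π : Ω' → Ω₁) (Y : Ω' → Rd d)
    (P₁ : Measure Ω₁) (Φ₁ : Ω₁ → LFMeasure d) (P₂ : Measure Ω₂) (Φ₂ : Ω₂ → LFMeasure d) :
    Prop where
  extension : MeasurePreserving π P' P₁
  measurable_vector : Measurable Y
  measurable_shift : Measurable (fun ω' => (Φ₁ (π ω')).shift (Y ω'))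
  map_eq : P'.map (fun ω' => (Φ₁ (π ω')).shift (Y ω')) = P₂.map Φ₂

end

/-!
Both couplings are instances of one statement about two stationary random measures `ξ`, `η` with
Palm measures `P_ξ`, `P_η`. For diagonally invariant `g`, the mass sent out from `ξ` in a window
`B` equals in mean the mass received by `η` in `B`. In terms of Palm measures this is Neveu's
exchange formula `E_ξ ∫ h(ω, y) η(dy) = E_η ∫ h(θ_x ω, -x) ξ(dx)`. Applied to
`h(ω, y) = F_ω(0, y) f(θ_y ω)`, its right-hand side is `E_η [f ∫ F(x, 0) ξ(dx)] = E_η f`, so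
shifting `P_ξ` by a point with law `F(0, ·) η` produces `P_η`. The Palm measure of `λ • volume` is
`P`; hence `(ξ, η) = (λ • volume, Ψ)` gives (i), and `(Ψ, λ • volume)` with the transposed density
gives (ii).
-/

open ProbabilityTheory

section Kernel

variable {α β : Type*} [MeasurableSpace α] [MeasurableSpace β]

lemma isSFiniteKernel_of_forall_isFiniteMeasure (κ : Kernel α β)
    (hκ : ∀ a, IsFiniteMeasure (κ a)) : IsSFiniteKernel κ := by
  let c : α → ℝ≥0 := fun a => 1 + (κ a univ).toNNReal
  have hc : Measurable c := (κ.measurable_coe .univ).ennreal_toNNReal.const_add 1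
  have hc_ne : ∀ a, c a ≠ 0 := fun a => by positivity
  let normalized : Kernel α β :=
    ⟨fun a => (c a)⁻¹ • κ a, Measure.measurable_of_measurable_coe _ fun s hs =>
      hc.inv.coe_nnreal_ennreal.mul (κ.measurable_coe hs)⟩
  have : IsFiniteKernel normalized := by
    refine ⟨1, ENNReal.one_lt_top, fun a => ?_⟩
    have hle : κ a univ ≤ c a := by
      rw [ENNReal.coe_add, ENNReal.coe_toNNReal (measure_ne_top _ _)]
      exact le_add_self
    calc ((c a)⁻¹ : ℝ≥0) * κ a univ ≤ ((c a)⁻¹ : ℝ≥0) * c a := by gcongr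
      _ = 1 := by rw [← ENNReal.coe_mul, inv_mul_cancel₀ (hc_ne a), ENNReal.coe_one]
  have hκ_eq : κ = normalized.withDensity fun a _ => c a := by
    ext1 a
    rw [Kernel.withDensity_apply _ (hc.comp measurable_fst).coe_nnreal_ennreal, withDensity_const]
    exact (smul_inv_smul₀ (hc_ne a) (κ a)).symm
  rw [hκ_eq]
  infer_instance

lemma isSFiniteKernel_of_measure_lt_top (κ : Kernel α β) {s : ℕ → Set β}
    (hs : ∀ n, MeasurableSet (s n)) (hs_univ : ⋃ n, s n = univ) (hκ : ∀ a n, κ a (s n) < ∞) :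
    IsSFiniteKernel κ := by
  have hD : ∀ n, MeasurableSet (disjointed s n) := MeasurableSet.disjointed hs
  have hκ_eq : κ = Kernel.sum fun n => κ.restrict (hD n) := by
    ext1 a
    rw [Kernel.sum_apply]
    simp only [Kernel.restrict_apply]
    rw [← Measure.restrict_iUnion (disjoint_disjointed s) hD, iUnion_disjointed, hs_univ,
      Measure.restrict_univ]
  rw [hκ_eq]
  refine Kernel.isSFiniteKernel_sum (hκs := fun n => ?_)
  refine isSFiniteKernel_of_forall_isFiniteMeasure _ fun a => ⟨?_⟩
  rw [Kernel.restrict_apply, Measure.restrict_apply_univ]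
  exact (measure_mono (disjointed_subset s n)).trans_lt (hκ a n)

lemma measurePreserving_prodMap_compProd {μ : Measure α} [SFinite μ] {κ : Kernel α β}
    [IsSFiniteKernel κ] {T : α → α} {S : β → β} (hT : MeasurePreserving T μ μ) (hS : Measurable S)
    (hκ : ∀ a, κ (T a) = (κ a).map S) :
    MeasurePreserving (Prod.map T S) (μ ⊗ₘ κ) (μ ⊗ₘ κ) := by
  have hTS : Measurable (Prod.map T S) := hT.measurable.prodMap hS
  refine ⟨hTS, Measure.ext_of_lintegral _ fun f hf => ?_⟩
  calc ∫⁻ p, f p ∂(μ ⊗ₘ κ).map (Prod.map T S)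
      = ∫⁻ a, ∫⁻ b, f (T a, S b) ∂κ a ∂μ := by
        rw [lintegral_map hf hTS]
        exact Measure.lintegral_compProd (hf.comp hTS)
    _ = ∫⁻ a, ∫⁻ b, f (T a, b) ∂κ (T a) ∂μ := by
        refine lintegral_congr fun a => ?_
        rw [hκ]
        exact (lintegral_map (hf.comp measurable_prodMk_left) hS).symm
    _ = ∫⁻ p, f p ∂(μ ⊗ₘ κ) := by
        rw [hT.lintegral_comp (f := fun a => ∫⁻ b, f (a, b) ∂κ a) hf.lintegral_kernel_prod_right',
          Measure.lintegral_compProd hf]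

end Kernel

section LFMeasure

variable {d : ℕ}

instance LFMeasure.isLocallyFiniteMeasure (φ : LFMeasure d) : IsLocallyFiniteMeasure φ.1 := φ.2

/-- The tautological kernel `φ ↦ φ` from locally finite measures on `ℝ^d` to `ℝ^d`. -/
def LFMeasure.kernel (d : ℕ) : Kernel (LFMeasure d) (Rd d) :=
  ⟨Subtype.val, measurable_subtype_coe⟩

instance LFMeasure.isSFiniteKernel_kernel : IsSFiniteKernel (LFMeasure.kernel d) :=
  isSFiniteKernel_of_measure_lt_top _
    (fun n : ℕ => (Metric.isClosed_closedBall (x := (0 : Rd d)) (ε := n)).measurableSet)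
    (Metric.iUnion_closedBall_nat 0)
    fun φ n => (isCompact_closedBall (0 : Rd d) n).measure_lt_top (μ := φ.1)

lemma LFMeasure.measurable_shift :
    Measurable fun p : LFMeasure d × Rd d => LFMeasure.shift p.2 p.1 := by
  refine Measurable.subtype_mk (Measure.measurable_of_measurable_coe _ fun A hA => ?_)
  let T : Set ((LFMeasure d × Rd d) × Rd d) := {q | q.2 - q.1.2 ∈ A}
  have hT : MeasurableSet T := (measurable_snd.sub measurable_fst.snd) hA
  let κ : Kernel (LFMeasure d × Rd d) (Rd d) := (LFMeasure.kernel d).comap Prod.fst measurable_fst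
  have hshift : ∀ p : LFMeasure d × Rd d,
      p.1.1.map (fun x => x - p.2) A = κ p (Prod.mk p ⁻¹' T) :=
    fun p => Measure.map_apply (measurable_id.sub_const p.2) hA
  simp only [hshift]
  exact Kernel.measurable_kernel_prodMk_left hT

/-- The multiple `c • volume` of Lebesgue measure, as an element of `LFMeasure d`. -/
noncomputable def LFMeasure.lebesgue (d : ℕ) (c : ℝ≥0) : LFMeasure d := ⟨c • volume, inferInstance⟩

lemma LFMeasure.shift_lebesgue (c : ℝ≥0) (s : Rd d) :
    (LFMeasure.lebesgue d c).shift s = LFMeasure.lebesgue d c := by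
  refine Subtype.ext ?_
  change Measure.map (fun x => x - s) (c • volume) = c • volume
  rw [Measure.map_smul, (measurePreserving_sub_right volume s).map_eq]

end LFMeasure

section MassTransport

variable {d : ℕ} {Ω : Type*} [MeasurableSpace Ω] {θ : MeasurableFlow d Ω} {P : Measure Ω}

lemma IsFlowStationary.withDensity (hP : IsFlowStationary θ P) {g : Ω → ℝ≥0∞} (hg : Measurable g)
    (hgθ : ∀ t ω, g (θ.toFun t ω) = g ω) : IsFlowStationary θ (P.withDensity g) := by
  refine fun t => ⟨(hP t).measurable, Measure.ext fun A hA => ?_⟩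
  have hA_shift : MeasurableSet (θ.toFun t ⁻¹' A) := (hP t).measurable hA
  rw [Measure.map_apply (hP t).measurable hA, withDensity_apply _ hA_shift, withDensity_apply _ hA,
    ← (hP t).setLIntegral_comp_preimage hA hg]
  simp only [hgθ]

lemma IsFlowStationary.measure_preimage_eq [SFinite P] (hP : IsFlowStationary θ P) {a b : Ω → Rd d}
    (ha : Measurable a) (hb : Measurable b) (haθ : ∀ t ω, a (θ.toFun t ω) = a ω - t)
    (hbθ : ∀ t ω, b (θ.toFun t ω) = b ω - t) {B : Set (Rd d)} (hB : MeasurableSet B)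
    (hB_pos : 0 < volume B) (hB_fin : volume B < ∞) : P (a ⁻¹' B) = P (b ⁻¹' B) := by
  let χ : Rd d → ℝ≥0∞ := B.indicator 1
  have hχ : Measurable χ := measurable_one.indicator hB
  have hχa : Measurable fun ω => χ (a ω) := hχ.comp ha
  have hχb : Measurable fun ω => χ (b ω) := hχ.comp hb
  have hwindow : ∀ {e : Ω → Rd d}, Measurable e → ∫⁻ ω, χ (e ω) ∂P = P (e ⁻¹' B) :=
    fun he => lintegral_indicator_one (he hB)
  have hmean_add : ∀ x c, ∫⁻ t, χ (x + t) * c = volume B * c := fun x c => by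
    rw [lintegral_add_left_eq_self (fun t => χ t * c), lintegral_mul_const c hχ,
      lintegral_indicator_one hB]
  have hmean_sub : ∀ x c, ∫⁻ t, χ (x - t) * c = volume B * c := fun x c => by
    rw [lintegral_sub_left_eq_self (fun t => χ t * c), lintegral_mul_const c hχ,
      lintegral_indicator_one hB]
  have hadd : Measurable fun p : Ω × Rd d => χ (b p.1 + p.2) * χ (a p.1) :=
    (hχ.comp ((hb.comp measurable_fst).add measurable_snd)).mul (hχa.comp measurable_fst)
  have hsub : Measurable fun p : Ω × Rd d => χ (a p.1 - p.2) * χ (b p.1) :=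
    (hχ.comp ((ha.comp measurable_fst).sub measurable_snd)).mul (hχb.comp measurable_fst)
  -- The shift by `t` turns the event `a ∈ B`, `b ∈ B - t` into `a ∈ B + t`, `b ∈ B`; integrating
  -- over `t` removes the condition on `b` from the former and the one on `a` from the latter.
  have hshift : ∀ t, ∫⁻ ω, χ (b ω + t) * χ (a ω) ∂P = ∫⁻ ω, χ (a ω - t) * χ (b ω) ∂P := fun t => by
    rw [← (hP t).lintegral_comp (f := fun ω => χ (b ω + t) * χ (a ω))
      (hadd.comp measurable_prodMk_right)]
    simp only [haθ, hbθ, sub_add_cancel, mul_comm]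
  rw [← hwindow ha, ← hwindow hb, ← ENNReal.mul_right_inj hB_pos.ne' hB_fin.ne]
  calc volume B * ∫⁻ ω, χ (a ω) ∂P
      = ∫⁻ ω, ∫⁻ t, χ (b ω + t) * χ (a ω) ∂volume ∂P := by
        simp only [hmean_add, lintegral_const_mul _ hχa]
    _ = ∫⁻ t, ∫⁻ ω, χ (b ω + t) * χ (a ω) ∂P := lintegral_lintegral_swap hadd.aemeasurable
    _ = ∫⁻ t, ∫⁻ ω, χ (a ω - t) * χ (b ω) ∂P := lintegral_congr hshift
    _ = ∫⁻ ω, ∫⁻ t, χ (a ω - t) * χ (b ω) ∂volume ∂P :=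
        (lintegral_lintegral_swap hsub.aemeasurable).symm
    _ = volume B * ∫⁻ ω, χ (b ω) ∂P := by
        simp only [hmean_sub, lintegral_const_mul _ hχb]

/-- The flow `t ↦ (θ_t ω, x - t, y - t)` on outcomes with two marked points of `ℝ^d`. -/
def MeasurableFlow.withTwoPoints (θ : MeasurableFlow d Ω) :
    MeasurableFlow d (Ω × Rd d × Rd d) where
  toFun t := Prod.map (θ.toFun t) fun q => (q.1 - t, q.2 - t)
  measurable_uncurry :=
    (θ.measurable_uncurry.comp (measurable_fst.fst.prodMk measurable_snd)).prodMk
      ((measurable_fst.snd.fst.sub measurable_snd).prodMk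
        (measurable_fst.snd.snd.sub measurable_snd))
  map_zero p := by simp [Prod.map, θ.map_zero]
  map_add s t p := by simp [Prod.map, θ.map_add, sub_sub, add_comm]

/-- `Ψ` is a measurable and flow-adapted family of locally finite measures; under a stationary `P`
it is a stationary random measure. -/
structure IsAdaptedRandomMeasure (θ : MeasurableFlow d Ω) (Ψ : Ω → LFMeasure d) : Prop where
  measurable : Measurable Ψ
  adapted : ∀ s ω, Ψ (θ.toFun s ω) = (Ψ ω).shift s

lemma isAdaptedRandomMeasure_lebesgue (θ : MeasurableFlow d Ω) (c : ℝ≥0) :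
    IsAdaptedRandomMeasure θ fun _ => LFMeasure.lebesgue d c :=
  ⟨measurable_const, fun s _ => (LFMeasure.shift_lebesgue c s).symm⟩

/-- A random measure, viewed as a kernel from `Ω` to `ℝ^d`. -/
def randomMeasureKernel (Ψ : Ω → LFMeasure d) (hΨ : Measurable Ψ) : Kernel Ω (Rd d) :=
  (LFMeasure.kernel d).comap Ψ hΨ

instance isSFiniteKernel_randomMeasureKernel (Ψ : Ω → LFMeasure d) (hΨ : Measurable Ψ) :
    IsSFiniteKernel (randomMeasureKernel Ψ hΨ) :=
  inferInstanceAs (IsSFiniteKernel ((LFMeasure.kernel d).comap Ψ hΨ))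

lemma randomMeasureKernel_apply (Ψ : Ω → LFMeasure d) (hΨ : Measurable Ψ) (ω : Ω) :
    randomMeasureKernel Ψ hΨ ω = (Ψ ω).1 := rfl

lemma measurable_lintegral_randomMeasure {Ψ : Ω → LFMeasure d} (hΨ : Measurable Ψ)
    {f : Ω → Rd d → ℝ≥0∞} (hf : Measurable fun p : Ω × Rd d => f p.1 p.2) :
    Measurable fun ω => ∫⁻ x, f ω x ∂(Ψ ω).1 :=
  hf.lintegral_kernel_prod_right' (κ := randomMeasureKernel Ψ hΨ)

variable {ξ η : Ω → LFMeasure d}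

lemma IsAdaptedRandomMeasure.lintegral_toFun (hξ : IsAdaptedRandomMeasure θ ξ) (s : Rd d) (ω : Ω)
    {f : Rd d → ℝ≥0∞} (hf : Measurable f) :
    ∫⁻ x, f x ∂(ξ (θ.toFun s ω)).1 = ∫⁻ x, f (x - s) ∂(ξ ω).1 := by
  rw [hξ.adapted]
  exact lintegral_map hf (measurable_id.sub_const s)

/-- The measure `P(dω) ξ_ω(dx) η_ω(dy)` on outcomes with two marked points: the Campbell measure of
the product random measure `ξ ⊗ η`. -/
noncomputable def twoPointCampbellMeasure (P : Measure Ω) (hξ : Measurable ξ) (hη : Measurable η) :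
    Measure (Ω × Rd d × Rd d) :=
  P ⊗ₘ (randomMeasureKernel ξ hξ ×ₖ randomMeasureKernel η hη)

instance sFinite_twoPointCampbellMeasure (P : Measure Ω) (hξ : Measurable ξ) (hη : Measurable η) :
    SFinite (twoPointCampbellMeasure P hξ hη) :=
  inferInstanceAs (SFinite (P ⊗ₘ (randomMeasureKernel ξ hξ ×ₖ randomMeasureKernel η hη)))

lemma setLIntegral_twoPointCampbellMeasure [SFinite P] (hξ : Measurable ξ) (hη : Measurable η)
    {g : Ω × Rd d × Rd d → ℝ≥0∞} (hg : Measurable g) {s t : Set (Rd d)} (hs : MeasurableSet s)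
    (ht : MeasurableSet t) :
    ∫⁻ p in univ ×ˢ s ×ˢ t, g p ∂twoPointCampbellMeasure P hξ hη =
      ∫⁻ ω, ∫⁻ q, g (ω, q) ∂((ξ ω).1.restrict s).prod ((η ω).1.restrict t) ∂P := by
  rw [twoPointCampbellMeasure, Measure.setLIntegral_compProd hg .univ (hs.prod ht),
    Measure.restrict_univ]
  simp only [Kernel.prod_apply, randomMeasureKernel_apply, Measure.prod_restrict]

lemma IsFlowStationary.withTwoPoints [SFinite P] (hP : IsFlowStationary θ P)
    (hξ : IsAdaptedRandomMeasure θ ξ) (hη : IsAdaptedRandomMeasure θ η) :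
    IsFlowStationary θ.withTwoPoints
      (twoPointCampbellMeasure P hξ.measurable hη.measurable) := by
  intro t
  have hsub : Measurable fun x : Rd d => x - t := measurable_id.sub_const t
  refine measurePreserving_prodMap_compProd (hP t)
    ((hsub.comp measurable_fst).prodMk (hsub.comp measurable_snd)) fun ω => ?_
  simp only [Kernel.prod_apply, randomMeasureKernel_apply, hξ.adapted, hη.adapted]
  exact Measure.map_prod_map _ _ hsub hsub

theorem IsFlowStationary.lintegral_massTransport [SFinite P] (hP : IsFlowStationary θ P)
    (hξ : IsAdaptedRandomMeasure θ ξ) (hη : IsAdaptedRandomMeasure θ η)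
    {g : Ω × Rd d × Rd d → ℝ≥0∞} (hg : Measurable g)
    (hgθ : ∀ t ω x y, g (θ.toFun t ω, x - t, y - t) = g (ω, x, y)) {B : Set (Rd d)}
    (hB : MeasurableSet B) (hB_pos : 0 < volume B) (hB_fin : volume B < ∞) :
    ∫⁻ ω, ∫⁻ x in B, ∫⁻ y, g (ω, x, y) ∂(η ω).1 ∂(ξ ω).1 ∂P =
      ∫⁻ ω, ∫⁻ y in B, ∫⁻ x, g (ω, x, y) ∂(ξ ω).1 ∂(η ω).1 ∂P := by
  have hsection : ∀ ω, Measurable fun q => g (ω, q) := fun ω => hg.comp measurable_prodMk_left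
  let Q := twoPointCampbellMeasure P hξ.measurable hη.measurable
  have hsymm := ((hP.withTwoPoints hξ hη).withDensity hg fun t p => hgθ t p.1 p.2.1 p.2.2)
    |>.measure_preimage_eq (a := fun p => p.2.1) (b := fun p => p.2.2) measurable_snd.fst
      measurable_snd.snd (fun _ _ => rfl) (fun _ _ => rfl) hB hB_pos hB_fin
  rw [withDensity_apply _ (measurable_snd.fst hB), withDensity_apply _ (measurable_snd.snd hB)]
    at hsymm
  calc ∫⁻ ω, ∫⁻ x in B, ∫⁻ y, g (ω, x, y) ∂(η ω).1 ∂(ξ ω).1 ∂P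
      = ∫⁻ p in univ ×ˢ B ×ˢ univ, g p ∂Q := by
        rw [setLIntegral_twoPointCampbellMeasure hξ.measurable hη.measurable hg hB .univ]
        simp only [Measure.restrict_univ]
        exact lintegral_congr fun ω => (lintegral_prod _ (hsection ω).aemeasurable).symm
    _ = ∫⁻ p in univ ×ˢ univ ×ˢ B, g p ∂Q := by
        convert hsymm using 3 <;> ext p <;> simp
    _ = ∫⁻ ω, ∫⁻ y in B, ∫⁻ x, g (ω, x, y) ∂(ξ ω).1 ∂(η ω).1 ∂P := by
        rw [setLIntegral_twoPointCampbellMeasure hξ.measurable hη.measurable hg .univ hB]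
        simp only [Measure.restrict_univ]
        exact lintegral_congr fun ω => lintegral_prod_symm _ (hsection ω).aemeasurable

end MassTransport

section Palm

variable {d : ℕ} {Ω : Type*} [MeasurableSpace Ω] {θ : MeasurableFlow d Ω} {P : Measure Ω}
  {B : Set (Rd d)}

lemma lintegral_palmMeasure (θ : MeasurableFlow d Ω) (P : Measure Ω) {Ψ : Ω → LFMeasure d}
    (hΨ : Measurable Ψ) (lam : ℝ≥0∞) (hB : MeasurableSet B) {f : Ω → ℝ≥0∞} (hf : Measurable f) :
    ∫⁻ ω, f ω ∂palmMeasure θ P Ψ lam B =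
      (lam * volume B)⁻¹ * ∫⁻ ω, ∫⁻ s in B, f (θ.toFun s ω) ∂(Ψ ω).1 ∂P := by
  rw [palmMeasure, lintegral_smul_measure, smul_eq_mul,
    Measure.lintegral_bind (measurable_palm_integrand θ hΨ hB).aemeasurable hf.aemeasurable]
  congr 1
  exact lintegral_congr fun ω =>
    lintegral_map hf (θ.measurable_uncurry.comp measurable_prodMk_left)

lemma isProbabilityMeasure_palmMeasure (θ : MeasurableFlow d Ω) {Ψ : Ω → LFMeasure d}
    (hΨ : Measurable Ψ) {lam : ℝ≥0∞} (hlam_pos : lam ≠ 0) (hlam_fin : lam ≠ ∞)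
    (hlam : IsIntensity P Ψ lam) (hB : MeasurableSet B) (hB_pos : 0 < volume B)
    (hB_fin : volume B < ∞) : IsProbabilityMeasure (palmMeasure θ P Ψ lam B) := by
  refine ⟨?_⟩
  rw [palmMeasure_apply θ P hΨ lam hB .univ]
  simp only [indicator_univ, Pi.one_apply, lintegral_one, Measure.restrict_apply_univ]
  rw [hlam B hB]
  exact ENNReal.inv_mul_cancel (mul_ne_zero hlam_pos hB_pos.ne')
    (ENNReal.mul_ne_top hlam_fin hB_fin.ne)

lemma ae_palmMeasure_of_ae_ae {Ψ : Ω → LFMeasure d} (hΨ : Measurable Ψ) (lam : ℝ≥0∞)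
    (hB : MeasurableSet B) {p : Ω → Prop} (hp : MeasurableSet {ω | p ω})
    (h : ∀ᵐ ω ∂P, ∀ᵐ s ∂(Ψ ω).1, p (θ.toFun s ω)) : ∀ᵐ ω ∂palmMeasure θ P Ψ lam B, p ω := by
  rw [ae_iff, ← compl_ofPred, palmMeasure_apply θ P hΨ lam hB hp.compl]
  refine mul_eq_zero_of_right _ (lintegral_eq_zero_of_ae_eq_zero ?_)
  filter_upwards [h] with ω hω
  refine lintegral_eq_zero_of_ae_eq_zero ?_
  filter_upwards [ae_restrict_of_ae hω] with s hs
  exact indicator_of_notMem (not_not_intro hs) _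

lemma IsFlowStationary.palmMeasure_lebesgue [SFinite P] (hP : IsFlowStationary θ P) {c : ℝ≥0}
    (hc : c ≠ 0) (hB : MeasurableSet B) (hB_pos : 0 < volume B) (hB_fin : volume B < ∞) :
    palmMeasure θ P (fun _ => LFMeasure.lebesgue d c) c B = P := by
  refine Measure.ext_of_lintegral _ fun f hf => ?_
  rw [lintegral_palmMeasure θ P measurable_const c hB hf,
    lintegral_lintegral_swap (f := fun ω s => f (θ.toFun s ω))
      (hf.comp θ.measurable_uncurry).aemeasurable]
  simp only [fun s => (hP s).lintegral_comp hf, setLIntegral_const]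
  change (c * volume B)⁻¹ * ((∫⁻ ω, f ω ∂P) * (c * volume B)) = ∫⁻ ω, f ω ∂P
  rw [mul_left_comm, ENNReal.inv_mul_cancel (mul_ne_zero (ENNReal.coe_ne_zero.2 hc) hB_pos.ne')
    (ENNReal.mul_ne_top ENNReal.coe_ne_top hB_fin.ne), mul_one]

theorem IsFlowStationary.neveu_exchange [SFinite P] (hP : IsFlowStationary θ P)
    {ξ η : Ω → LFMeasure d} (hξ : IsAdaptedRandomMeasure θ ξ) (hη : IsAdaptedRandomMeasure θ η)
    (lam : ℝ≥0∞) (hB : MeasurableSet B) (hB_pos : 0 < volume B) (hB_fin : volume B < ∞)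
    {h : Ω → Rd d → ℝ≥0∞} (hh : Measurable fun p : Ω × Rd d => h p.1 p.2) :
    ∫⁻ ω, ∫⁻ y, h ω y ∂(η ω).1 ∂palmMeasure θ P ξ lam B =
      ∫⁻ ω, ∫⁻ x, h (θ.toFun x ω) (-x) ∂(ξ ω).1 ∂palmMeasure θ P η lam B := by
  have hθ := θ.measurable_uncurry
  have hh_shift : Measurable fun p : Ω × Rd d => h (θ.toFun p.2 p.1) (-p.2) :=
    hh.comp (hθ.prodMk measurable_snd.neg)
  let g : Ω × Rd d × Rd d → ℝ≥0∞ := fun p => h (θ.toFun p.2.1 p.1) (p.2.2 - p.2.1)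
  have hg : Measurable g := hh.comp
    ((hθ.comp (measurable_fst.prodMk measurable_snd.fst)).prodMk
      (measurable_snd.snd.sub measurable_snd.fst))
  have hgθ : ∀ t ω x y, g (θ.toFun t ω, x - t, y - t) = g (ω, x, y) := fun t ω x y => by
    simp only [g, θ.map_add, sub_add_cancel, sub_sub_sub_cancel_right]
  rw [lintegral_palmMeasure θ P hξ.measurable lam hB
      (measurable_lintegral_randomMeasure hη.measurable hh),
    lintegral_palmMeasure θ P hη.measurable lam hB
      (measurable_lintegral_randomMeasure hξ.measurable hh_shift)]
  congr 1
  have hsent : ∀ ω x, ∫⁻ y, h (θ.toFun x ω) y ∂(η (θ.toFun x ω)).1 =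
      ∫⁻ y, g (ω, x, y) ∂(η ω).1 :=
    fun ω x => hη.lintegral_toFun x ω (hh.comp measurable_prodMk_left)
  have hreceived : ∀ ω y, ∫⁻ x, h (θ.toFun x (θ.toFun y ω)) (-x) ∂(ξ (θ.toFun y ω)).1 =
      ∫⁻ x, g (ω, x, y) ∂(ξ ω).1 := fun ω y => by
    refine (hξ.lintegral_toFun y ω (hh_shift.comp measurable_prodMk_left)).trans ?_
    simp only [g, Function.comp_apply, θ.map_add, sub_add_cancel, neg_sub]
  simp only [hsent, hreceived]
  exact hP.lintegral_massTransport hξ hη hg hgθ hB hB_pos hB_fin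

end Palm

section Coupling

variable {d : ℕ} {Ω : Type*} [MeasurableSpace Ω] {θ : MeasurableFlow d Ω} {P : Measure Ω}
  {F : Ω → Rd d → Rd d → ℝ≥0}

lemma IsFlowAdaptedFunction.swap (hF : IsFlowAdaptedFunction θ F) :
    IsFlowAdaptedFunction θ fun ω x y => F ω y x :=
  ⟨hF.measurable.comp (measurable_fst.prodMk (measurable_snd.snd.prodMk measurable_snd.fst)),
    fun s ω x y => hF.adapted s ω y x⟩

lemma IsFlowAdaptedFunction.measurable_zero_left (hF : IsFlowAdaptedFunction θ F) :
    Measurable fun p : Ω × Rd d => (F p.1 0 p.2 : ℝ≥0∞) :=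
  (hF.measurable.comp
    (measurable_fst.prodMk (measurable_const.prodMk measurable_snd))).coe_nnreal_ennreal

lemma IsFlowAdaptedFunction.measurable_left (hF : IsFlowAdaptedFunction θ F) (ω : Ω) (y : Rd d) :
    Measurable fun x => (F ω x y : ℝ≥0∞) :=
  (hF.measurable.comp
    (measurable_const.prodMk (measurable_id.prodMk measurable_const))).coe_nnreal_ennreal

/-- The kernel `ω ↦ F_ω(0, ·) η_ω`, along which mass at the origin is transported to `η`. -/
noncomputable def transportKernel (η : Ω → LFMeasure d) (hη : Measurable η)
    (F : Ω → Rd d → Rd d → ℝ≥0) : Kernel Ω (Rd d) :=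
  (randomMeasureKernel η hη).withDensity fun ω y => (F ω 0 y : ℝ≥0∞)

instance isSFiniteKernel_transportKernel (η : Ω → LFMeasure d) (hη : Measurable η)
    (F : Ω → Rd d → Rd d → ℝ≥0) : IsSFiniteKernel (transportKernel η hη F) :=
  inferInstanceAs (IsSFiniteKernel
    ((randomMeasureKernel η hη).withDensity fun ω y => (F ω 0 y : ℝ≥0∞)))

lemma transportKernel_apply {η : Ω → LFMeasure d} (hη : Measurable η)
    (hF : IsFlowAdaptedFunction θ F) (ω : Ω) :
    transportKernel η hη F ω = (η ω).1.withDensity fun y => (F ω 0 y : ℝ≥0∞) :=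
  Kernel.withDensity_apply _ hF.measurable_zero_left ω

variable {ξ η : Ω → LFMeasure d} {B : Set (Rd d)}

lemma ae_palmMeasure_lintegral_eq_one (hξ : IsAdaptedRandomMeasure θ ξ) (hη : Measurable η)
    (hF : IsFlowAdaptedFunction θ F)
    (hFbal : ∀ᵐ ω ∂P, ∀ᵐ y ∂(η ω).1, ∫⁻ x, (F ω x y : ℝ≥0∞) ∂(ξ ω).1 = 1)
    (lam : ℝ≥0∞) (hB : MeasurableSet B) :
    ∀ᵐ ω ∂palmMeasure θ P η lam B, ∫⁻ x, (F ω x 0 : ℝ≥0∞) ∂(ξ ω).1 = 1 := by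
  refine ae_palmMeasure_of_ae_ae hη lam hB
    (measurable_lintegral_randomMeasure hξ.measurable hF.swap.measurable_zero_left
      (measurableSet_singleton 1)) ?_
  filter_upwards [hFbal] with ω hω
  filter_upwards [hω] with y hy
  rw [hξ.lintegral_toFun y ω (hF.measurable_left _ 0), ← hy]
  simp only [hF.adapted, sub_add_cancel, zero_add]

theorem IsFlowStationary.map_compProd_transportKernel [SFinite P] (hP : IsFlowStationary θ P)
    (hξ : IsAdaptedRandomMeasure θ ξ) (hη : IsAdaptedRandomMeasure θ η)
    (hF : IsFlowAdaptedFunction θ F)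
    (hFbal : ∀ᵐ ω ∂P, ∀ᵐ y ∂(η ω).1, ∫⁻ x, (F ω x y : ℝ≥0∞) ∂(ξ ω).1 = 1)
    (lam : ℝ≥0∞) (hB : MeasurableSet B) (hB_pos : 0 < volume B) (hB_fin : volume B < ∞)
    [SFinite (palmMeasure θ P ξ lam B)] :
    (palmMeasure θ P ξ lam B ⊗ₘ transportKernel η hη.measurable F).map
      (fun p => θ.toFun p.2 p.1) = palmMeasure θ P η lam B := by
  have hθ := θ.measurable_uncurry
  refine Measure.ext_of_lintegral _ fun f hf => ?_
  have hF_shift : ∀ ω x, F (θ.toFun x ω) 0 (-x) = F ω x 0 := fun ω x => by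
    rw [hF.adapted, zero_add, neg_add_cancel]
  have hf_shift : ∀ ω x, f (θ.toFun (-x) (θ.toFun x ω)) = f ω := fun ω x => by
    rw [θ.map_add, neg_add_cancel, θ.map_zero]
  calc ∫⁻ ω, f ω ∂(palmMeasure θ P ξ lam B ⊗ₘ transportKernel η hη.measurable F).map
        (fun p => θ.toFun p.2 p.1)
      = ∫⁻ ω, ∫⁻ y, (F ω 0 y : ℝ≥0∞) * f (θ.toFun y ω) ∂(η ω).1 ∂palmMeasure θ P ξ lam B := by
        rw [lintegral_map hf hθ]
        refine (Measure.lintegral_compProd (hf.comp hθ)).trans ?_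
        exact lintegral_congr fun ω => Kernel.lintegral_withDensity _ hF.measurable_zero_left ω
          ((hf.comp hθ).comp measurable_prodMk_left)
    _ = ∫⁻ ω, ∫⁻ x, (F ω x 0 : ℝ≥0∞) * f ω ∂(ξ ω).1 ∂palmMeasure θ P η lam B := by
        rw [hP.neveu_exchange hξ hη lam hB hB_pos hB_fin
          (hF.measurable_zero_left.mul (hf.comp hθ))]
        simp only [hF_shift, hf_shift]
    _ = ∫⁻ ω, f ω ∂palmMeasure θ P η lam B := by
        refine lintegral_congr_ae ?_
        filter_upwards [ae_palmMeasure_lintegral_eq_one hξ hη.measurable hF hFbal lam hB] with ω hω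
        rw [lintegral_mul_const _ (hF.measurable_left ω 0), hω, one_mul]

lemma HasCondDistribGiven.map_prodMk {Ω' S E : Type*} [MeasurableSpace Ω'] [MeasurableSpace S]
    [MeasurableSpace E] {P' : Measure Ω'} [IsFiniteMeasure P'] {Q : Measure Ω} [SFinite Q]
    {π : Ω' → Ω} (hπ : MeasurePreserving π P' Q) {Y : Ω' → E} (hY : Measurable Y) {X : Ω → S}
    (hX : Measurable X) {κ : Kernel Ω E} [IsSFiniteKernel κ]
    (h : HasCondDistribGiven P' Y (fun ω' => X (π ω')) fun ω' => κ (π ω')) :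
    P'.map (fun ω' => (X (π ω'), Y ω')) = (Q ⊗ₘ κ).map (Prod.map X id) := by
  have hXY : Measurable fun ω' => (X (π ω'), Y ω') := (hX.comp hπ.measurable).prodMk hY
  refine Measure.ext_prod fun {s t} hs ht => ?_
  rw [Measure.map_apply hXY (hs.prod ht),
    Measure.map_apply (hX.prodMap measurable_id) (hs.prod ht), mk_preimage_prod, h s hs t ht,
    preimage_prod_map_prod, preimage_id, Measure.compProd_apply_prod (hX hs) ht]
  exact hπ.setLIntegral_comp_preimage (hX hs) (κ.measurable_coe ht)

lemma HasCondDistribGiven.isShiftCoupling {Ω' : Type*} [MeasurableSpace Ω'] {P' : Measure Ω'}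
    {Q₁ Q₂ : Measure Ω} [IsFiniteMeasure Q₁] {π : Ω' → Ω} (hπ : MeasurePreserving π P' Q₁)
    {Y : Ω' → Rd d} (hY : Measurable Y) {Ψ : Ω → LFMeasure d} (hΨ : IsAdaptedRandomMeasure θ Ψ)
    {κ : Kernel Ω (Rd d)} [IsSFiniteKernel κ]
    (h : HasCondDistribGiven P' Y (fun ω' => Ψ (π ω')) fun ω' => κ (π ω'))
    (hκ : (Q₁ ⊗ₘ κ).map (fun p => θ.toFun p.2 p.1) = Q₂) :
    IsShiftCoupling P' π Y Q₁ Ψ Q₂ Ψ := by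
  have : IsFiniteMeasure P' :=
    ⟨(hπ.measure_preimage nullMeasurableSet_univ).trans_lt (measure_lt_top Q₁ univ)⟩
  have hshift : Measurable fun p : LFMeasure d × Rd d => LFMeasure.shift p.2 p.1 :=
    LFMeasure.measurable_shift
  have hΨY : Measurable fun ω' => (Ψ (π ω'), Y ω') := (hΨ.measurable.comp hπ.measurable).prodMk hY
  refine ⟨hπ, hY, hshift.comp hΨY, ?_⟩
  calc P'.map (fun ω' => (Ψ (π ω')).shift (Y ω'))
      = (P'.map fun ω' => (Ψ (π ω'), Y ω')).map fun p => LFMeasure.shift p.2 p.1 :=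
        (Measure.map_map hshift hΨY).symm
    _ = (Q₁ ⊗ₘ κ).map (fun p => (Ψ p.1).shift p.2) := by
        rw [h.map_prodMk hπ hY hΨ.measurable,
          Measure.map_map hshift (hΨ.measurable.prodMap measurable_id)]
        rfl
    _ = Q₂.map Ψ := by
        rw [← hκ, Measure.map_map hΨ.measurable θ.measurable_uncurry]
        simp only [Function.comp_def, hΨ.adapted]

theorem IsFlowStationary.isShiftCoupling_palmMeasure [SFinite P] (hP : IsFlowStationary θ P)
    (hξ : IsAdaptedRandomMeasure θ ξ) (hη : IsAdaptedRandomMeasure θ η)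
    (hF : IsFlowAdaptedFunction θ F)
    (hFbal : ∀ᵐ ω ∂P, ∀ᵐ y ∂(η ω).1, ∫⁻ x, (F ω x y : ℝ≥0∞) ∂(ξ ω).1 = 1)
    (lam : ℝ≥0∞) (hB : MeasurableSet B) (hB_pos : 0 < volume B) (hB_fin : volume B < ∞)
    [IsFiniteMeasure (palmMeasure θ P ξ lam B)] {Ψ : Ω → LFMeasure d}
    (hΨ : IsAdaptedRandomMeasure θ Ψ) {Ω' : Type*} [MeasurableSpace Ω'] {P' : Measure Ω'}
    {π : Ω' → Ω} (hπ : MeasurePreserving π P' (palmMeasure θ P ξ lam B)) {Y : Ω' → Rd d}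
    (hY : Measurable Y)
    (hcond : HasCondDistribGiven P' Y (fun ω' => Ψ (π ω'))
      fun ω' => (η (π ω')).1.withDensity fun y => (F (π ω') 0 y : ℝ≥0∞)) :
    IsShiftCoupling P' π Y (palmMeasure θ P ξ lam B) Ψ (palmMeasure θ P η lam B) Ψ := by
  simp only [← transportKernel_apply hη.measurable hF] at hcond
  exact hcond.isShiftCoupling hπ hY hΨ
    (hP.map_compProd_transportKernel hξ hη hF hFbal lam hB hB_pos hB_fin)

end Coupling

theorem theorem3p6_general {d : ℕ} {Ω : Type*} [MeasurableSpace Ω] {θ : MeasurableFlow d Ω}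
    {P : Measure Ω} [IsFiniteMeasure P] (hP : IsFlowStationary θ P) {Ψ : Ω → LFMeasure d}
    (hΨ : IsAdaptedRandomMeasure θ Ψ) {lam : ℝ≥0} (hlam_pos : 0 < lam)
    (hlam : IsIntensity P Ψ lam) {F : Ω → Rd d → Rd d → ℝ≥0} (hF : IsFlowAdaptedFunction θ F)
    (hleft : ∀ᵐ ω ∂P, ∀ᵐ x ∂(lam • (volume : Measure (Rd d))),
      ∫⁻ ξ, (F ω x ξ : ℝ≥0∞) ∂(Ψ ω).1 = 1)
    (hright : ∀ᵐ ω ∂P, ∀ᵐ ξ ∂(Ψ ω).1,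
      ∫⁻ x, (F ω x ξ : ℝ≥0∞) ∂(lam • (volume : Measure (Rd d))) = 1)
    {B : Set (Rd d)} (hB : MeasurableSet B) (hB_pos : 0 < volume B) (hB_fin : volume B < ∞) :
    IsProbabilityMeasure (palmMeasure θ P Ψ lam B) ∧
    (∀ {Ω' : Type*} [MeasurableSpace Ω'] (P' : Measure Ω') (π : Ω' → Ω) (Y : Ω' → Rd d),
      MeasurePreserving π P' P → Measurable Y →
      HasCondDistribGiven P' Y (fun ω' => Ψ (π ω'))
        (fun ω' => (Ψ (π ω')).1.withDensity (fun ξ => (F (π ω') 0 ξ : ℝ≥0∞))) →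
      IsShiftCoupling P' π Y P Ψ (palmMeasure θ P Ψ lam B) Ψ) ∧
    (∀ {Ω' : Type*} [MeasurableSpace Ω'] (P' : Measure Ω') (π : Ω' → Ω) (Y : Ω' → Rd d),
      MeasurePreserving π P' (palmMeasure θ P Ψ lam B) → Measurable Y →
      HasCondDistribGiven P' Y (fun ω' => Ψ (π ω'))
        (fun ω' => (lam • (volume : Measure (Rd d))).withDensity
          (fun x => (F (π ω') x 0 : ℝ≥0∞))) →
      IsShiftCoupling P' π Y (palmMeasure θ P Ψ lam B) Ψ P Ψ) := by
  have hΦ := isAdaptedRandomMeasure_lebesgue θ lam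
  have hpalmΦ := hP.palmMeasure_lebesgue hlam_pos.ne' hB hB_pos hB_fin
  have hpalmΨ : IsProbabilityMeasure (palmMeasure θ P Ψ lam B) :=
    isProbabilityMeasure_palmMeasure θ hΨ.measurable (ENNReal.coe_ne_zero.2 hlam_pos.ne')
      ENNReal.coe_ne_top hlam hB hB_pos hB_fin
  refine ⟨hpalmΨ, fun P' π Y hπ hY hcond => ?_, fun P' π Y hπ hY hcond => ?_⟩
  · have : IsFiniteMeasure (palmMeasure θ P (fun _ => LFMeasure.lebesgue d lam) lam B) := by
      rwa [hpalmΦ]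
    have hcoupling := hP.isShiftCoupling_palmMeasure hΦ hΨ hF hright lam hB hB_pos hB_fin hΨ
      (by rwa [hpalmΦ]) hY hcond
    rwa [hpalmΦ] at hcoupling
  · have hcoupling := hP.isShiftCoupling_palmMeasure hΨ hΦ hF.swap hleft lam hB hB_pos hB_fin hΨ
      hπ hY hcond
    rwa [hpalmΦ] at hcoupling

theorem theorem3p6 {d : ℕ} {Ω : Type*} [MeasurableSpace Ω] (θ : MeasurableFlow d Ω)
    (P : Measure Ω) (Ψ : Ω → LFMeasure d) (hΨ : IsErgodicRandomMeasure θ P Ψ)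
    (lam : ℝ≥0) (hlam_pos : 0 < lam) (hlam : IsIntensity P Ψ lam)
    (F : Ω → Rd d → Rd d → ℝ≥0) (hF : IsFlowAdaptedFunction θ F)
    (hFbal : ∀ᵐ ω ∂P, IsBalancingDensity (lam • (volume : Measure (Rd d))) (Ψ ω).1 (F ω))
    (B : Set (Rd d)) (hB : MeasurableSet B) (hB_pos : 0 < volume B) (hB_fin : volume B < ∞) :
    IsProbabilityMeasure (palmMeasure θ P Ψ lam B) ∧
    (∀ {Ω' : Type*} [MeasurableSpace Ω'] (P' : Measure Ω') (π : Ω' → Ω) (Y : Ω' → Rd d),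
      MeasurePreserving π P' P → Measurable Y →
      HasCondDistribGiven P' Y (fun ω' => Ψ (π ω'))
        (fun ω' => (Ψ (π ω')).1.withDensity (fun ξ => (F (π ω') 0 ξ : ℝ≥0∞))) →
      IsShiftCoupling P' π Y P Ψ (palmMeasure θ P Ψ lam B) Ψ) ∧
    (∀ {Ω' : Type*} [MeasurableSpace Ω'] (P' : Measure Ω') (π : Ω' → Ω) (Y : Ω' → Rd d),
      MeasurePreserving π P' (palmMeasure θ P Ψ lam B) → Measurable Y →
      HasCondDistribGiven P' Y (fun ω' => Ψ (π ω'))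
        (fun ω' => (lam • (volume : Measure (Rd d))).withDensity
          (fun x => (F (π ω') x 0 : ℝ≥0∞))) →
      IsShiftCoupling P' π Y (palmMeasure θ P Ψ lam B) Ψ P Ψ) := by
  have := hΨ.prob
  exact theorem3p6_general hΨ.ergodic.1 ⟨hΨ.measurable, hΨ.adapted⟩ hlam_pos hlam hF
    (hFbal.mono fun _ h => h.left_eq) (hFbal.mono fun _ h => h.right_eq) hB hB_pos hB_fin
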